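/- Let $p(z)=p_0+p_1z+\dots+p_nz^n$ be a complex polynomial of degree $n\ge 1$. Let $C\in\mathbb C^{n\times n}$ be its companion matrix, with first row $(-p_{n-1}/p_n,\dots,-p_0/p_n)$, ones on the subdiagonal and zeros elsewhere. Let $U$ be the cyclic shift matrix, with ones on the subdiagonal and in position $(1,n)$ and zeros elsewhere (for $n=1$, $U=(1)$), and let $\mathbf p\in\mathbb C^n$ be given by $\mathbf p^H=(p_{n-1}/p_n,\dots,p_1/p_n,\,p_0/p_n+1)$, so that $C=U-e_1\mathbf p^H$. Let $P=(\delta_{i,\pi(j)})$ be the permutation matrix of $\pi(1)=1$, $\pi(2k)=k+1$, $\pi(2k+1)=n-k+1$ $(k\ge 1)$, and put $\widehat C=P^TCP$, $\widehat U=P^TUP$, $\widehat p=P^T\mathbf p$, so that $\widehat C=\widehat U-e_1\widehat p^H$. Let $\rho_0,\rho_1,\dots\in\mathbb C$ be arbitrary shifts, let $A_0=\widehat C$, and for $s\ge0$ let $$A_s-\rho_sI=Q_sR_s,\qquad A_{s+1}=Q_s^HA_sQ_s,$$ with $Q_s$ unitary and $R_s$ upper triangular. If $A_s-\rho_sI$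 is invertible, any such QR factorization is allowed. If $A_s-\rho_sI$ is singular, $Q_s$ is required to be a limit of unitary QR factors of invertible matrices $A_s-\mu I$ with $\mu\to\rho_s$ (as is the case for the value at $\mu=\rho_s$ of any continuous branch of QR factorizations of $A_s-\mu I$). Put $U_0=\widehat U$, $z_0=e_1$, $w_0=\widehat p$ and $$U_{s+1}=Q_s^HU_sQ_s,\qquad z_{s+1}=Q_s^Hz_s,\qquad w_{s+1}=Q_s^Hw_s\qquad(s\ge0).$$ Then for all $s\ge0$ the matrix $U_s$ is unitary, $A_s=U_s-z_sw_s^H$, and $$\operatorname{rank}U_s(1{:}2j,\;2(j+1)+1{:}n)\le1,\qquad 1\le j\le\lfloor (n+1)/2\rfloor-2 .$$ Moreover, if $A_0$ is invertible, then for all $s\ge 0$ one has $z_s^HU_sw_s\ne1$, and the matrix $$B_s=\frac{U_sw_sz_s^HU_s}{z_s^HU_sw_s-1}$$ satisfies $$U_s(1{:}2j,\;2(j+1)+1{:}n)=B_s(1{:}2j,\;2(j+1)+1{:}n),\qquad 1\le j\le\lfloor (n+1)/2\rfloor-2,$$ and $B_{s+1}=Q_s^HB_sQ_s$. The matrix $B_s$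 has rank at most one, and rank exactly one unless $p(z)=p_n(z^n-1)$ (in which case $w_0=0$). -/

import Mathlib

open Polynomial

noncomputable section

namespace CompanionQR

/-! All matrix indices below are zero-based: the row `i : Fin n` is the row number `i + 1`. -/

/-- The companion matrix `C(p)` of `p = p₀ + p₁ z + ⋯ + pₙ zⁿ`: first row
`(-pₙ₋₁/pₙ, …, -p₀/pₙ)`, ones on the subdiagonal, zeros elsewhere. -/
def companion (p : ℂ[X]) (n : ℕ) : Matrix (Fin n) (Fin n) ℂ :=
  Matrix.of fun i j =>
    if i.val = 0 then -(p.coeff (n - 1 - j.val) / p.coeff n)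
    else if i.val = j.val + 1 then 1 else 0

/-- The cyclic down-shift `U`: ones on the subdiagonal and in the upper right corner. -/
def cyclicShift (n : ℕ) : Matrix (Fin n) (Fin n) ℂ :=
  Matrix.of fun i j =>
    if i.val = j.val + 1 ∨ (i.val = 0 ∧ j.val + 1 = n) then 1 else 0

/-- The first vector `e₁` of the standard basis. -/
def firstVec (n : ℕ) : Fin n → ℂ := fun i => if i.val = 0 then 1 else 0

/-- The vector `𝐩`, given by `𝐩ᴴ = (pₙ₋₁/pₙ, pₙ₋₂/pₙ, …, p₁/pₙ, p₀/pₙ + 1)`. -/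
def coeffVec (p : ℂ[X]) (n : ℕ) : Fin n → ℂ := fun j =>
  star (p.coeff (n - 1 - j.val) / p.coeff n + if j.val + 1 = n then 1 else 0)

/-- The permutation `π` in zero-based form: one-based it reads `π(1) = 1`, `π(2k) = k + 1`,
`π(2k + 1) = n - k + 1` for `k ≥ 1`. -/
def permVal (n j : ℕ) : ℕ :=
  if j = 0 then 0 else if j % 2 = 1 then (j + 1) / 2 else n - j / 2

/-- The permutation matrix `P = (δ_{i, π(j)})`. -/
def permMatrix (n : ℕ) : Matrix (Fin n) (Fin n) ℂ :=
  Matrix.of fun i j => if i.val = permVal n j.val then 1 else 0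

/-- The permuted companion matrix `Ĉ = Pᵀ C P`. -/
def permCompanion (p : ℂ[X]) (n : ℕ) : Matrix (Fin n) (Fin n) ℂ :=
  (permMatrix n).transpose * companion p n * permMatrix n

/-- The CMV-like shaped unitary matrix `Û = Pᵀ U P`. -/
def permCyclicShift (n : ℕ) : Matrix (Fin n) (Fin n) ℂ :=
  (permMatrix n).transpose * cyclicShift n * permMatrix n

/-- The permuted vector `p̂ = Pᵀ 𝐩`. -/
def permCoeffVec (p : ℂ[X]) (n : ℕ) : Fin n → ℂ :=
  (permMatrix n).transpose.mulVec (coeffVec p n)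

/-- `M = Q R` with `Q` unitary and `R` upper triangular. -/
structure IsQR {n : ℕ} (M Q R : Matrix (Fin n) (Fin n) ℂ) : Prop where
  unitary : Q ∈ Matrix.unitaryGroup (Fin n) ℂ
  upper : R.BlockTriangular id
  eq_mul : M = Q * R

/-- The pairs `(μ, Q)` such that `A - μ I` is invertible and `Q` is a unitary factor of a QR
factorization of it. -/
def regularFactors {n : ℕ} (A : Matrix (Fin n) (Fin n) ℂ) :
    Set (ℂ × Matrix (Fin n) (Fin n) ℂ) :=
  {x | IsUnit (A - x.1 • (1 : Matrix (Fin n) (Fin n) ℂ)) ∧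
    ∃ R, IsQR (A - x.1 • (1 : Matrix (Fin n) (Fin n) ℂ)) x.2 R}

/-- The shifted QR iteration `A_s - ρ_s I = Q_s R_s`, `A_{s+1} = Q_sᴴ A_s Q_s`, started at `A₀`.
The field `branch` says that the chosen factor `Q_s` is a limit of unitary QR factors of
invertible matrices `A_s - μ I`, `μ → ρ_s`. It holds for every QR factorization if `A_s - ρ_s I`
is invertible (see `mem_closure_regularFactors`), so it matters only if the shift `ρ_s` is an
eigenvalue of `A_s`, where `Q_s` need not be essentially unique; there, it holds for the value at
`ρ_s` of every continuous branch `μ ↦ (Q(μ), R(μ))` of QR factorizations of `A_s - μ I`. -/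
structure IsShiftedQR {n : ℕ} (A₀ : Matrix (Fin n) (Fin n) ℂ) (ρ : ℕ → ℂ)
    (A Q R : ℕ → Matrix (Fin n) (Fin n) ℂ) : Prop where
  init : A 0 = A₀
  factor : ∀ s, IsQR (A s - ρ s • (1 : Matrix (Fin n) (Fin n) ℂ)) (Q s) (R s)
  branch : ∀ s, (ρ s, Q s) ∈ closure (regularFactors (A s))
  step : ∀ s, A (s + 1) = (Q s).conjTranspose * A s * Q s

/-- For an invertible `A - μ I` every QR factorization satisfies the branch condition. -/
theorem mem_closure_regularFactors {n : ℕ} {A Q R : Matrix (Fin n) (Fin n) ℂ} {μ : ℂ}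
    (hA : IsUnit (A - μ • (1 : Matrix (Fin n) (Fin n) ℂ)))
    (h : IsQR (A - μ • (1 : Matrix (Fin n) (Fin n) ℂ)) Q R) :
    (μ, Q) ∈ closure (regularFactors A) :=
  subset_closure ⟨hA, R, h⟩

/-- `U₀ = Û`, `U_{s+1} = Q_sᴴ U_s Q_s`. -/
def seqU {n : ℕ} (Q : ℕ → Matrix (Fin n) (Fin n) ℂ) : ℕ → Matrix (Fin n) (Fin n) ℂ
  | 0 => permCyclicShift n
  | s + 1 => (Q s).conjTranspose * seqU Q s * Q s

/-- `z₀ = e₁`, `z_{s+1} = Q_sᴴ z_s`. -/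
def seqZ {n : ℕ} (Q : ℕ → Matrix (Fin n) (Fin n) ℂ) : ℕ → Fin n → ℂ
  | 0 => firstVec n
  | s + 1 => (Q s).conjTranspose.mulVec (seqZ Q s)

/-- `w₀ = p̂`, `w_{s+1} = Q_sᴴ w_s`. -/
def seqW (p : ℂ[X]) {n : ℕ} (Q : ℕ → Matrix (Fin n) (Fin n) ℂ) : ℕ → Fin n → ℂ
  | 0 => permCoeffVec p n
  | s + 1 => (Q s).conjTranspose.mulVec (seqW p Q s)

/-- The scalar `z_sᴴ U_s w_s - 1`. -/
def denomB (p : ℂ[X]) {n : ℕ} (Q : ℕ → Matrix (Fin n) (Fin n) ℂ) (s : ℕ) : ℂ :=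
  star (seqZ Q s) ⬝ᵥ (seqU Q s).mulVec (seqW p Q s) - 1

/-- `B_s = (U_s w_s)(z_sᴴ U_s) / (z_sᴴ U_s w_s - 1)`. -/
def seqB (p : ℂ[X]) {n : ℕ} (Q : ℕ → Matrix (Fin n) (Fin n) ℂ) (s : ℕ) :
    Matrix (Fin n) (Fin n) ℂ :=
  (denomB p Q s)⁻¹ • Matrix.vecMulVec ((seqU Q s).mulVec (seqW p Q s))
    (Matrix.vecMul (star (seqZ Q s)) (seqU Q s))

/-- The block `M(1:2j, 2(j+1)+1:n)` (one-based rows `1, …, 2j`, columns `2j+3, …, n`). -/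
def upperBlock {n : ℕ} (M : Matrix (Fin n) (Fin n) ℂ) (j : ℕ) :
    Matrix {i : Fin n // i.val < 2 * j} {k : Fin n // 2 * (j + 1) ≤ k.val} ℂ :=
  M.submatrix Subtype.val Subtype.val

end CompanionQR

end

/-! If `T = A - μI` is invertible with unitary factor `V`, then `Vᴴ T = R` and `V = T S`, where `R`
and `S = R⁻¹` are upper triangular. So `Vᴴ K V = R K S` for every `K` commuting with `A`, and zero
lower left blocks of `K` survive a QR step. Such conditions are closed in `V`, so they pass to the
limits allowed at singular shifts.

If `zᴴ U w ≠ 1`, Sherman-Morrison gives `A⁻¹ = (U - B)ᴴ`, which commutes with `A`; its relevant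
lower left block vanishes initially by the shape of `Û`. Hence `U` and `B` agree on the upper block
(`IsShiftedQR.lowerZero`).

If `zᴴ U w = 1`, `A` is singular and `Uᴴ` commutes with `A` only up to two rank one terms built from
the kernel vectors `x = Uᴴ z` and `y = wᴴ Uᴴ`. The invariant becomes: `x` vanishes in the lower
rows, and the block of `Uᴴ` extended by the row `y` has rank at most one
(`IsShiftedQR.lowerRankOne`). -/

noncomputable section

namespace CompanionQR

open Matrix

variable {n : ℕ}

/-! ### Conditions on lower left blocks and their closedness. -/

/-- The entries in the rows `a, a + 1, …` and the columns `0, …, b - 1` vanish. -/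
def LowerZero (a b : ℕ) (M : Matrix (Fin n) (Fin n) ℂ) : Prop :=
  ∀ i k : Fin n, a ≤ i.val → k.val < b → M i k = 0

/-- The lower left block of `M`, augmented by the row `v`, is a rank one matrix. -/
def LowerRankOne (a b : ℕ) (M : Matrix (Fin n) (Fin n) ℂ) (v : Fin n → ℂ) : Prop :=
  ∃ (l r : Fin n → ℂ) (c : ℂ), LowerZero a b (M - vecMulVec l r) ∧
    ∀ k : Fin n, k.val < b → v k = c * r k

theorem upper_mulVec_apply_eq_zero {R : Matrix (Fin n) (Fin n) ℂ} (hR : R.BlockTriangular id)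
    {a : ℕ} {x : Fin n → ℂ} (hx : ∀ i : Fin n, a ≤ i.val → x i = 0) (i : Fin n)
    (hi : a ≤ i.val) : (R *ᵥ x) i = 0 := by
  rw [mulVec, dotProduct]
  refine Finset.sum_eq_zero fun j _ => ?_
  by_cases h : j < i
  · rw [hR h, zero_mul]
  · rw [hx j (hi.trans (not_lt.mp h)), mul_zero]

theorem vecMul_upper_apply_eq_zero {S : Matrix (Fin n) (Fin n) ℂ} (hS : S.BlockTriangular id)
    {b : ℕ} {x : Fin n → ℂ} (hx : ∀ i : Fin n, i.val < b → x i = 0) (i : Fin n)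
    (hi : i.val < b) : (x ᵥ* S) i = 0 := by
  rw [vecMul, dotProduct]
  refine Finset.sum_eq_zero fun j _ => ?_
  by_cases h : i < j
  · rw [hS h, mul_zero]
  · rw [hx j (lt_of_le_of_lt (not_lt.mp h) hi), zero_mul]

theorem LowerZero.upper_mul {a b : ℕ} {M R : Matrix (Fin n) (Fin n) ℂ} (hM : LowerZero a b M)
    (hR : R.BlockTriangular id) : LowerZero a b (R * M) := fun i k hi hk =>
  upper_mulVec_apply_eq_zero hR (x := fun j => M j k) (fun j hj => hM j k hj hk) i hi

theorem LowerZero.mul_upper {a b : ℕ} {M S : Matrix (Fin n) (Fin n) ℂ} (hM : LowerZero a b M)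
    (hS : S.BlockTriangular id) : LowerZero a b (M * S) := fun i k hi hk =>
  vecMul_upper_apply_eq_zero hS (x := fun j => M i j) (fun j hj => hM i j hi hj) k hk

/-- Vanishing of 2×2 minors is a polynomial condition, so it survives limits, whereas the witnesses
`l`, `r`, `c` need not converge. -/
theorem lowerRankOne_iff_minors {a b : ℕ} {M : Matrix (Fin n) (Fin n) ℂ} {v : Fin n → ℂ} :
    LowerRankOne a b M v ↔
      (∀ i i' k k' : Fin n, a ≤ i.val → a ≤ i'.val → k.val < b → k'.val < b →
        M i k * M i' k' = M i k' * M i' k) ∧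
      (∀ i k k' : Fin n, a ≤ i.val → k.val < b → k'.val < b → M i k * v k' = M i k' * v k) := by
  constructor
  · rintro ⟨l, r, c, hM, hv⟩
    have hM' : ∀ i k : Fin n, a ≤ i.val → k.val < b → M i k = l i * r k := fun i k hi hk => by
      have := hM i k hi hk
      rwa [Matrix.sub_apply, vecMulVec_apply, sub_eq_zero] at this
    refine ⟨fun i i' k k' hi hi' hk hk' => ?_, fun i k k' hi hk hk' => ?_⟩
    · rw [hM' i k hi hk, hM' i' k' hi' hk', hM' i k' hi hk', hM' i' k hi' hk]; ring
    · rw [hM' i k hi hk, hM' i k' hi hk', hv k hk, hv k' hk']; ring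
  · rintro ⟨h1, h2⟩
    by_cases h : LowerZero a b M
    · exact ⟨0, v, 1, by rwa [zero_vecMulVec, sub_zero], by simp⟩
    · simp only [LowerZero, not_forall] at h
      obtain ⟨i₀, k₀, hi₀, hk₀, h0⟩ := h
      -- The column and row through a nonzero pivot span the block.
      refine ⟨fun i => M i k₀ / M i₀ k₀, M i₀, v k₀ / M i₀ k₀, fun i k hi hk => ?_,
        fun k hk => ?_⟩
      · rw [Matrix.sub_apply, vecMulVec_apply, sub_eq_zero, div_mul_eq_mul_div, eq_div_iff h0,
          h1 i i₀ k k₀ hi hi₀ hk hk₀]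
      · rw [div_mul_eq_mul_div, eq_div_iff h0, mul_comm, h2 i₀ k₀ k hi₀ hk₀ hk, mul_comm]

theorem isClosed_setOf_lowerZero {X : Type*} [TopologicalSpace X] {a b : ℕ}
    {f : X → Matrix (Fin n) (Fin n) ℂ} (hf : Continuous f) :
    IsClosed {x | LowerZero a b (f x)} := by
  simp only [LowerZero, Set.ofPred_forall]
  exact isClosed_iInter fun i => isClosed_iInter fun k => isClosed_iInter fun _ =>
    isClosed_iInter fun _ => isClosed_eq (hf.matrix_elem i k) continuous_const

theorem isClosed_setOf_lowerRankOne {X : Type*} [TopologicalSpace X] {a b : ℕ}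
    {f : X → Matrix (Fin n) (Fin n) ℂ} {g : X → Fin n → ℂ} (hf : Continuous f)
    (hg : Continuous g) : IsClosed {x | LowerRankOne a b (f x) (g x)} := by
  have hf' : ∀ i k, Continuous fun x => f x i k := fun i k => hf.matrix_elem i k
  have hg' : ∀ k, Continuous fun x => g x k := fun k => (continuous_apply k).comp hg
  simp only [lowerRankOne_iff_minors, Set.ofPred_and, Set.ofPred_forall]
  refine IsClosed.inter ?_ ?_
  · exact isClosed_iInter fun i => isClosed_iInter fun i' => isClosed_iInter fun k =>
      isClosed_iInter fun k' => isClosed_iInter fun _ => isClosed_iInter fun _ =>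
      isClosed_iInter fun _ => isClosed_iInter fun _ =>
      isClosed_eq ((hf' i k).mul (hf' i' k')) ((hf' i k').mul (hf' i' k))
  · exact isClosed_iInter fun i => isClosed_iInter fun k => isClosed_iInter fun k' =>
      isClosed_iInter fun _ => isClosed_iInter fun _ => isClosed_iInter fun _ =>
      isClosed_eq ((hf' i k).mul (hg' k')) ((hf' i k').mul (hg' k))

/-! ### One QR step. -/

theorem exists_upper_inverse {A Q : Matrix (Fin n) (Fin n) ℂ} {μ : ℂ}
    (h : (μ, Q) ∈ regularFactors A) :
    ∃ R S : Matrix (Fin n) (Fin n) ℂ, R.BlockTriangular id ∧ S.BlockTriangular id ∧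
      Qᴴ * (A - μ • (1 : Matrix (Fin n) (Fin n) ℂ)) = R ∧
      (A - μ • (1 : Matrix (Fin n) (Fin n) ℂ)) * S = Q := by
  obtain ⟨hT, R, hQ, hR, hQR⟩ := h
  simp only at hT hQ hQR
  have hR' : Qᴴ * (A - μ • (1 : Matrix (Fin n) (Fin n) ℂ)) = R := by
    rw [hQR, ← mul_assoc, ← star_eq_conjTranspose, mem_unitaryGroup_iff'.mp hQ, one_mul]
  have hU : IsUnit R := by
    rw [← hR']
    refine IsUnit.mul ?_ hT
    exact IsUnit.of_mul_eq_one Q (by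
      rw [← star_eq_conjTranspose]; exact mem_unitaryGroup_iff'.mp hQ)
  have := hU.invertible
  refine ⟨R, R⁻¹, hR, blockTriangular_inv_of_blockTriangular hR, hR', ?_⟩
  rw [hQR, mul_assoc, mul_inv_of_invertible, mul_one]

theorem of_mem_closure_regularFactors {A Q : Matrix (Fin n) (Fin n) ℂ} {ρ : ℂ}
    {P : Matrix (Fin n) (Fin n) ℂ → Prop} (hP : IsClosed {V | P V})
    (h : ∀ μ V, (μ, V) ∈ regularFactors A → P V) (hQ : (ρ, Q) ∈ closure (regularFactors A)) :
    P Q :=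
  closure_minimal (fun x hx => h x.1 x.2 hx) (hP.preimage continuous_snd) hQ

/-- A step of the QR iteration preserves the zeros in the lower left corner of a matrix
commuting with `A`. -/
theorem LowerZero.conj_of_mem_closure {a b : ℕ} {A K Q : Matrix (Fin n) (Fin n) ℂ} {ρ : ℂ}
    (hQ : (ρ, Q) ∈ closure (regularFactors A)) (hAK : A * K = K * A) (hK : LowerZero a b K) :
    LowerZero a b (Qᴴ * K * Q) := by
  refine of_mem_closure_regularFactors (P := fun V => LowerZero a b (Vᴴ * K * V))
    (isClosed_setOf_lowerZero (by fun_prop)) (fun μ V hV => ?_) hQ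
  obtain ⟨R, S, hR, hS, hVR, hVS⟩ := exists_upper_inverse hV
  -- Write `V = T S`, move `T` to the left of `K`, and absorb it in `Vᴴ T = R`.
  have : Vᴴ * K * V = R * K * S := by
    have hcomm : K * (A - μ • 1) = (A - μ • 1) * K := by simp [mul_sub, sub_mul, hAK]
    rw [← hVR, mul_assoc Vᴴ _ K, ← hcomm, mul_assoc Vᴴ K V, mul_assoc Vᴴ, mul_assoc K, hVS]
  rw [this]
  exact (hK.upper_mul hR).mul_upper hS

/-- A step of the QR iteration for a singular `A = U - z wᴴ`, where `M = U⁻¹`, `x = M z` and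
`y = wᴴ M`. -/
theorem lowerRankOne_conj_of_mem_closure {a b : ℕ} {A M Q : Matrix (Fin n) (Fin n) ℂ}
    {x y z w : Fin n → ℂ} {ρ : ℂ} (hQ : (ρ, Q) ∈ closure (regularFactors A))
    (hMA : M * A = A * M + vecMulVec z y - vecMulVec x w) (hAx : A *ᵥ x = 0) (hyA : y ᵥ* A = 0)
    (hx : ∀ i : Fin n, a ≤ i.val → x i = 0) (hM : LowerRankOne a b M y) :
    (∀ i : Fin n, a ≤ i.val → (Qᴴ *ᵥ x) i = 0) ∧ LowerRankOne a b (Qᴴ * M * Q) (y ᵥ* Q) := by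
  have hclosed : IsClosed {V : Matrix (Fin n) (Fin n) ℂ | (∀ i : Fin n, a ≤ i.val →
      (Vᴴ *ᵥ x) i = 0) ∧ LowerRankOne a b (Vᴴ * M * V) (y ᵥ* V)} := by
    rw [Set.ofPred_and]
    refine IsClosed.inter ?_ (isClosed_setOf_lowerRankOne (by fun_prop) (by fun_prop))
    simp only [Set.ofPred_forall]
    exact isClosed_iInter fun i => isClosed_iInter fun _ => isClosed_eq
      ((continuous_apply i).comp (f := fun V : Matrix (Fin n) (Fin n) ℂ => Vᴴ *ᵥ x)
        (by fun_prop)) continuous_const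
  refine of_mem_closure_regularFactors (P := fun V => (∀ i : Fin n, a ≤ i.val →
    (Vᴴ *ᵥ x) i = 0) ∧ LowerRankOne a b (Vᴴ * M * V) (y ᵥ* V)) hclosed (fun μ V hV => ?_) hQ
  obtain ⟨R, S, hR, hS, hVR, hVS⟩ := exists_upper_inverse hV
  have hT := hV.1
  simp only at hT
  set T := A - μ • (1 : Matrix (Fin n) (Fin n) ℂ) with hTdef
  have hTx : T *ᵥ x = -μ • x := by simp [hTdef, sub_mulVec, hAx, smul_mulVec]
  have hyT : y ᵥ* T = -μ • y := by simp [hTdef, vecMul_sub, hyA, vecMul_smul]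
  have hx' : ∀ i : Fin n, a ≤ i.val → (Vᴴ *ᵥ x) i = 0 := by
    -- For `μ ≠ 0`, `R x = Vᴴ T x = -μ Vᴴ x` shows that `Vᴴ x` inherits the zeros of `R x`; for `μ =
    -- 0`, `T = A` is injective and kills `x`.
    by_cases hμ : μ = 0
    · have : x = 0 := by
        apply mulVec_injective_of_isUnit hT
        rw [hTx, hμ]; simp
      simp [this]
    · intro i hi
      have h1 : (R *ᵥ x) i = 0 := upper_mulVec_apply_eq_zero hR hx i hi
      rw [← hVR, ← mulVec_mulVec, hTx, mulVec_smul, Pi.smul_apply, smul_eq_mul] at h1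
      exact (mul_eq_zero.mp h1).resolve_left (neg_ne_zero.mpr hμ)
  refine ⟨hx', ?_⟩
  obtain ⟨l, r, c, hlr, hy⟩ := hM
  have hMT : M * T = T * M + vecMulVec z y - vecMulVec x w := by
    simp only [hTdef, mul_sub, sub_mul, hMA]
    simp only [mul_smul_comm, smul_mul_assoc, mul_one, one_mul]
    abel
  have key : Vᴴ * M * V = R * M * S + vecMulVec (Vᴴ *ᵥ z) (y ᵥ* S)
      - vecMulVec (Vᴴ *ᵥ x) (w ᵥ* S) := by
    rw [mul_assoc Vᴴ, show M * V = M * T * S by rw [mul_assoc, hVS], ← mul_assoc, hMT]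
    rw [mul_sub, mul_add, sub_mul, add_mul, ← mul_assoc, hVR, mul_vecMulVec, mul_vecMulVec,
      vecMulVec_mul, vecMulVec_mul]
  have hyS : ∀ k : Fin n, k.val < b → (y ᵥ* S) k = c * (r ᵥ* S) k := by
    intro k hk
    have := vecMul_upper_apply_eq_zero hS (x := y - c • r) (b := b)
      (fun i hi => by simp [hy i hi]) k hk
    rwa [sub_vecMul, smul_vecMul, Pi.sub_apply, sub_eq_zero] at this
  -- In these rows the `Vᴴ x` term of `key` is zero. In these columns `y S = c (r S)`, so the `z`
  -- term has the same row factor as `R M S`. Finally `y V = y T S = -μ y S`.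
  refine ⟨R *ᵥ l + c • (Vᴴ *ᵥ z), r ᵥ* S, -μ * c, fun i k hi hk => ?_, fun k hk => ?_⟩
  · have h0 := ((hlr.upper_mul hR).mul_upper hS) i k hi hk
    rw [mul_sub, sub_mul, mul_vecMulVec, vecMulVec_mul] at h0
    simp only [Matrix.sub_apply, vecMulVec_apply] at h0
    simp only [key, Matrix.sub_apply, Matrix.add_apply, vecMulVec_apply, hx' i hi, hyS k hk,
      Pi.add_apply, Pi.smul_apply, smul_eq_mul]
    linear_combination h0
  · rw [← hVS, ← vecMul_vecMul, hyT, smul_vecMul, Pi.smul_apply, hyS k hk, smul_eq_mul, mul_assoc]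

/-! ### The permuted cyclic shift and the initial data. -/

theorem permVal_lt {j : ℕ} (hj : j < n) : permVal n j < n := by
  unfold permVal; split_ifs <;> omega

theorem permVal_injective {i j : ℕ} (hi : i < n) (hj : j < n) (h : permVal n i = permVal n j) :
    i = j := by
  unfold permVal at h; split_ifs at h <;> omega

/-- The permutation `π` of the index set. -/
def permEquiv (n : ℕ) : Equiv.Perm (Fin n) :=
  Equiv.ofBijective (fun j => ⟨permVal n j, permVal_lt j.2⟩) <|
    Finite.injective_iff_bijective.mp fun i j h =>
      Fin.ext (permVal_injective i.2 j.2 (Fin.ext_iff.mp h))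

theorem permEquiv_val (j : Fin n) : (permEquiv n j).val = permVal n j := rfl

theorem permMatrix_apply (i j : Fin n) :
    permMatrix n i j = if i = permEquiv n j then 1 else 0 := by
  simp [permMatrix, Fin.ext_iff, permEquiv_val]

theorem transpose_permMatrix_mul_apply (M : Matrix (Fin n) (Fin n) ℂ) (i j : Fin n) :
    ((permMatrix n)ᵀ * M) i j = M (permEquiv n i) j := by
  simp [mul_apply, permMatrix_apply]

theorem mul_permMatrix_apply (M : Matrix (Fin n) (Fin n) ℂ) (i j : Fin n) :
    (M * permMatrix n) i j = M i (permEquiv n j) := by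
  simp [mul_apply, permMatrix_apply]

theorem transpose_permMatrix_mulVec (v : Fin n → ℂ) (i : Fin n) :
    ((permMatrix n)ᵀ *ᵥ v) i = v (permEquiv n i) := by
  simp [mulVec, dotProduct, permMatrix_apply]

theorem permCyclicShift_apply (i j : Fin n) :
    permCyclicShift n i j = cyclicShift n (permEquiv n i) (permEquiv n j) := by
  rw [permCyclicShift, mul_permMatrix_apply, transpose_permMatrix_mul_apply]

theorem cyclicShift_apply (i j : Fin n) :
    cyclicShift n i j = if i = finRotate n j then 1 else 0 := by
  cases n with
  | zero => exact i.elim0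
  | succ m =>
    simp only [cyclicShift, of_apply]
    refine if_congr ?_ rfl rfl
    rw [Fin.ext_iff, coe_finRotate]
    have := i.2
    have := j.2
    split_ifs with h
    · rw [h, Fin.val_last]; omega
    · have : j.val ≠ m := fun h' => h (Fin.ext h')
      omega

theorem permCyclicShift_mem_unitaryGroup : permCyclicShift n ∈ unitaryGroup (Fin n) ℂ := by
  have hU : ∀ i j : Fin n, permCyclicShift n i j =
      if i = (permEquiv n).symm (finRotate n (permEquiv n j)) then 1 else 0 := fun i j => by
    simp only [permCyclicShift_apply, cyclicShift_apply, Equiv.eq_symm_apply]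
  rw [mem_unitaryGroup_iff']
  ext i j
  simp [mul_apply, hU, star_eq_conjTranspose, one_apply, eq_comm]

/-- `permVal` folds the cycle in half, so cyclic neighbours end up at most two positions apart. -/
theorem permCyclicShift_apply_eq_zero {i k : Fin n} {b : ℕ} (hi : i.val < b)
    (hk : b + 2 ≤ k.val) (hb : Even b) : permCyclicShift n i k = 0 := by
  rw [permCyclicShift_apply]
  have := i.2
  have := k.2
  obtain ⟨c, rfl⟩ := hb
  refine if_neg ?_
  rw [permEquiv_val, permEquiv_val]
  rintro (h | ⟨h, h'⟩)
  · unfold permVal at h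
    split_ifs at h <;> omega
  · unfold permVal at h h'
    split_ifs at h h' <;> omega

/-- The cyclic predecessor of `0` is `n - 1`, which `permVal` attains at index `2` once `n ≥ 3`. -/
theorem permCyclicShift_zero_apply {i k : Fin n} (hi : i.val = 0) (hk : 3 ≤ k.val) :
    permCyclicShift n i k = 0 := by
  rw [permCyclicShift_apply]
  have := i.2
  have := k.2
  refine if_neg ?_
  rw [permEquiv_val, permEquiv_val]
  rintro (h | ⟨h, h'⟩)
  · unfold permVal at h
    split_ifs at h
  · unfold permVal at h h'
    split_ifs at h h' <;> omega

theorem companion_eq (p : ℂ[X]) :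
    companion p n = cyclicShift n - vecMulVec (firstVec n) (star (coeffVec p n)) := by
  ext i j
  have := j.2
  simp only [companion, cyclicShift, firstVec, coeffVec, of_apply, Matrix.sub_apply,
    vecMulVec_apply, Pi.star_apply, star_star]
  by_cases hi : i.val = 0
  · by_cases hj : j.val + 1 = n <;> simp [hi, hj]
  · simp [hi]

theorem permCompanion_eq (p : ℂ[X]) : permCompanion p n =
    permCyclicShift n - vecMulVec (firstVec n) (star (permCoeffVec p n)) := by
  have hz : ∀ i : Fin n, (permEquiv n i).val = 0 ↔ i.val = 0 := fun i => by
    have := i.2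
    rw [permEquiv_val]; unfold permVal; split_ifs <;> omega
  ext i j
  rw [permCompanion, mul_permMatrix_apply, transpose_permMatrix_mul_apply, companion_eq,
    Matrix.sub_apply, Matrix.sub_apply, permCyclicShift_apply, vecMulVec_apply, vecMulVec_apply,
    Pi.star_apply, Pi.star_apply, permCoeffVec, transpose_permMatrix_mulVec]
  simp [firstVec, hz]

theorem permCoeffVec_ne_zero {p : ℂ[X]} (hn : 1 ≤ n) (hp : p.natDegree = n)
    (h : p ≠ C p.leadingCoeff * (X ^ n - 1)) : permCoeffVec p n ≠ 0 := by
  intro h0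
  have hl : p.coeff n ≠ 0 := by
    rw [← hp, coeff_natDegree, leadingCoeff_ne_zero]
    rintro rfl
    simp at hp; omega
  apply h
  ext k
  have hlc : p.leadingCoeff = p.coeff n := by rw [← hp]; rfl
  rw [coeff_C_mul, coeff_sub, coeff_X_pow, coeff_one, hlc]
  rcases lt_trichotomy k n with hk | rfl | hk
  · have h1 := congrFun h0 ((permEquiv n).symm ⟨n - 1 - k, by omega⟩)
    rw [permCoeffVec, transpose_permMatrix_mulVec, Equiv.apply_symm_apply] at h1
    simp only [coeffVec, Pi.zero_apply, star_eq_zero] at h1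
    rw [show n - 1 - (n - 1 - k) = k by omega] at h1
    rw [if_neg hk.ne]
    by_cases hk0 : k = 0
    · subst hk0
      rw [if_pos (by omega), div_add_one hl, div_eq_zero_iff] at h1
      have := h1.resolve_right hl
      simp only [if_true]
      linear_combination this
    · rw [if_neg (by omega), add_zero, div_eq_zero_iff] at h1
      rw [h1.resolve_right hl, if_neg hk0]
      simp
  · rw [if_pos rfl, if_neg (by omega)]; simp
  · rw [coeff_eq_zero_of_natDegree_lt (by omega), if_neg (by omega), if_neg (by omega)]; simp

/-! ### Unitary matrices minus a rank one term, and ranks of blocks. -/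

/-- In the singular case `z* U w = 1`, the vectors `U* z` and `w* U*` span the right and left
kernels of `U - z w*`, and `U*` commutes with `U - z w*` up to rank one terms. -/
theorem unitary_sub_rankOne_singular {U : Matrix (Fin n) (Fin n) ℂ} {z w : Fin n → ℂ}
    (hU : U ∈ unitaryGroup (Fin n) ℂ) (h : star z ⬝ᵥ U *ᵥ w = 1) :
    (U - vecMulVec z (star w)) *ᵥ (Uᴴ *ᵥ z) = 0 ∧
      (star w ᵥ* Uᴴ) ᵥ* (U - vecMulVec z (star w)) = 0 ∧
      Uᴴ * (U - vecMulVec z (star w)) = (U - vecMulVec z (star w)) * Uᴴ +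
        vecMulVec z (star w ᵥ* Uᴴ) - vecMulVec (Uᴴ *ᵥ z) (star w) := by
  have h1 : U * Uᴴ = 1 := mem_unitaryGroup_iff.mp hU
  have h2 : Uᴴ * U = 1 := mem_unitaryGroup_iff'.mp hU
  have h3 : star w ⬝ᵥ Uᴴ *ᵥ z = 1 := by
    rw [dotProduct_mulVec, ← star_mulVec, ← star_star z, star_dotProduct_star, h,
      star_one]
  refine ⟨?_, ?_, ?_⟩
  · rw [sub_mulVec, mulVec_mulVec, h1, vecMulVec_mulVec, h3]; simp
  · rw [vecMul_sub, vecMul_vecMul, h2, vecMul_vecMulVec, ← dotProduct_mulVec, h3]; simp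
  · rw [mul_sub, sub_mul, h1, h2, mul_vecMulVec, vecMulVec_mul]; abel

/-- The inverse of `U - z w*` for a unitary `U`. -/
theorem unitary_sub_rankOne_mul_inverse {U : Matrix (Fin n) (Fin n) ℂ} {z w : Fin n → ℂ} {d : ℂ}
    (hU : U ∈ unitaryGroup (Fin n) ℂ) (hd : star z ⬝ᵥ U *ᵥ w - 1 = d) (h : d ≠ 0) :
    (U - vecMulVec z (star w)) * (U - d⁻¹ • vecMulVec (U *ᵥ w) (star z ᵥ* U))ᴴ = 1 := by
  have h1 : U * Uᴴ = 1 := mem_unitaryGroup_iff.mp hU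
  have h3 : star w ⬝ᵥ Uᴴ *ᵥ z = 1 + star d := by
    rw [dotProduct_mulVec, ← star_mulVec, ← star_star z, star_dotProduct_star, ← hd,
      star_sub, star_one]
    ring
  have h4 : star d ≠ 0 := star_ne_zero.mpr h
  rw [conjTranspose_sub, conjTranspose_smul, conjTranspose_vecMulVec, star_vecMul, star_star,
    star_mulVec, star_inv₀, mul_sub, sub_mul, sub_mul, h1, vecMulVec_mul, mul_smul_comm,
    mul_smul_comm, mul_vecMulVec, mulVec_mulVec, h1, one_mulVec, vecMulVec_mul_vecMulVec, h3]
  ext i j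
  simp only [Matrix.sub_apply, Matrix.smul_apply, vecMulVec_apply, Pi.smul_apply, smul_eq_mul]
  field_simp
  ring

theorem rank_upperBlock_smul_vecMulVec_le (c : ℂ) (u v : Fin n → ℂ) (j : ℕ) :
    (upperBlock (c • vecMulVec u v) j).rank ≤ 1 := by
  have h : upperBlock (c • vecMulVec u v) j =
      vecMulVec (fun i => c * u i.val) (fun k => v k.val) := by
    ext i k
    simp [upperBlock, vecMulVec_apply, mul_assoc]
  rw [h]
  exact rank_vecMulVec_le _ _

theorem rank_vecMulVec_eq_one {u v : Fin n → ℂ} (hu : u ≠ 0) (hv : v ≠ 0) :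
    (vecMulVec u v).rank = 1 := by
  refine le_antisymm (rank_vecMulVec_le u v) (Nat.one_le_iff_ne_zero.mpr fun h => ?_)
  obtain ⟨i, hi⟩ := Function.ne_iff.mp hu
  obtain ⟨k, hk⟩ := Function.ne_iff.mp hv
  rw [Matrix.rank, Submodule.finrank_eq_zero, LinearMap.range_eq_bot] at h
  have h1 := congrFun (LinearMap.congr_fun h (Pi.single k 1)) i
  simp only [mulVecLin_apply, mulVec_single_one, LinearMap.zero_apply, Pi.zero_apply, col_apply,
    vecMulVec_apply, mul_eq_zero] at h1
  exact h1.elim hi hk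

theorem LowerRankOne.rank_upperBlock_le {U : Matrix (Fin n) (Fin n) ℂ} {v : Fin n → ℂ} {j : ℕ}
    (h : LowerRankOne (2 * (j + 1)) (2 * j) Uᴴ v) : (upperBlock U j).rank ≤ 1 := by
  obtain ⟨l, r, _, hM, _⟩ := h
  have : upperBlock U j = vecMulVec (fun i => star (r i.val)) (fun k => star (l k.val)) := by
    ext i k
    have := hM k.val i.val k.2 i.2
    rw [Matrix.sub_apply, vecMulVec_apply, sub_eq_zero, conjTranspose_apply] at this
    rw [upperBlock, submatrix_apply, vecMulVec_apply, ← star_star (U _ _), this, star_mul]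
  rw [this]
  exact rank_vecMulVec_le _ _

/-! ### The invariants along the iteration. -/

section Iteration

variable {p : ℂ[X]} {ρ : ℕ → ℂ} {A Q R : ℕ → Matrix (Fin n) (Fin n) ℂ}

theorem seqU_mem_unitaryGroup (hQ : ∀ s, Q s ∈ unitaryGroup (Fin n) ℂ) :
    ∀ s, seqU Q s ∈ unitaryGroup (Fin n) ℂ
  | 0 => permCyclicShift_mem_unitaryGroup
  | s + 1 => mul_mem (mul_mem (Unitary.star_mem (hQ s)) (seqU_mem_unitaryGroup hQ s)) (hQ s)

/-- Invariance under unitary conjugation lets the split `zᴴ U w = 1` or not be decided once, at `s =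
0`. -/
theorem denomB_succ (hQ : ∀ s, Q s ∈ unitaryGroup (Fin n) ℂ) (s : ℕ) :
    denomB p Q (s + 1) = denomB p Q s := by
  have h : Q s * (Q s)ᴴ = 1 := mem_unitaryGroup_iff.mp (hQ s)
  simp only [denomB, seqU, seqZ, seqW]
  rw [star_mulVec, conjTranspose_conjTranspose, dotProduct_mulVec, vecMul_vecMul,
    ← dotProduct_mulVec, mulVec_mulVec, ← mul_assoc, ← mul_assoc, h, one_mul, mul_assoc, h, mul_one]

theorem denomB_eq (hQ : ∀ s, Q s ∈ unitaryGroup (Fin n) ℂ) :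
    ∀ s, denomB p Q s = denomB p Q 0
  | 0 => rfl
  | s + 1 => (denomB_succ hQ s).trans (denomB_eq hQ s)

theorem seqU_mulVec_seqW_succ (hQ : ∀ s, Q s ∈ unitaryGroup (Fin n) ℂ) (s : ℕ) :
    seqU Q (s + 1) *ᵥ seqW p Q (s + 1) = (Q s)ᴴ *ᵥ (seqU Q s *ᵥ seqW p Q s) := by
  have h : Q s * (Q s)ᴴ = 1 := mem_unitaryGroup_iff.mp (hQ s)
  simp only [seqU, seqW]
  rw [mulVec_mulVec, mulVec_mulVec, mul_assoc, h, mul_one]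

theorem seqZ_vecMul_seqU_succ (hQ : ∀ s, Q s ∈ unitaryGroup (Fin n) ℂ) (s : ℕ) :
    star (seqZ Q (s + 1)) ᵥ* seqU Q (s + 1) = (star (seqZ Q s) ᵥ* seqU Q s) ᵥ* Q s := by
  have h : Q s * (Q s)ᴴ = 1 := mem_unitaryGroup_iff.mp (hQ s)
  simp only [seqU, seqZ]
  rw [star_mulVec, conjTranspose_conjTranspose, vecMul_vecMul, vecMul_vecMul, ← mul_assoc,
    ← mul_assoc, h, one_mul]

theorem seqB_succ (hQ : ∀ s, Q s ∈ unitaryGroup (Fin n) ℂ) (s : ℕ) :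
    seqB p Q (s + 1) = (Q s)ᴴ * seqB p Q s * Q s := by
  rw [seqB, seqB, denomB_succ hQ, seqU_mulVec_seqW_succ hQ, seqZ_vecMul_seqU_succ hQ,
    mul_smul_comm, smul_mul_assoc, mul_vecMulVec, vecMulVec_mul]

theorem IsShiftedQR.eq_sub (hA : IsShiftedQR (permCompanion p n) ρ A Q R) :
    ∀ s, A s = seqU Q s - vecMulVec (seqZ Q s) (star (seqW p Q s))
  | 0 => by rw [hA.init, permCompanion_eq]; rfl
  | s + 1 => by
    rw [hA.step, hA.eq_sub s]
    simp only [seqU, seqZ, seqW]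
    rw [mul_sub, sub_mul, mul_vecMulVec, vecMulVec_mul, star_mulVec, conjTranspose_conjTranspose]

/-- A zero denominator would put the nonzero vector `U₀ᴴ e₁` in the kernel of `A 0`. -/
theorem IsShiftedQR.denomB_ne_zero (hn : 1 ≤ n)
    (hA : IsShiftedQR (permCompanion p n) ρ A Q R) (h0 : IsUnit (A 0)) (s : ℕ) :
    denomB p Q s ≠ 0 := by
  have hU := seqU_mem_unitaryGroup (fun s => (hA.factor s).unitary) 0
  rw [denomB_eq fun s => (hA.factor s).unitary]
  intro h
  have h1 := (unitary_sub_rankOne_singular hU (sub_eq_zero.mp h)).1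
  rw [← hA.eq_sub] at h1
  have h2 : (seqU Q 0)ᴴ *ᵥ seqZ Q 0 = 0 :=
    mulVec_injective_of_isUnit h0 (h1.trans (mulVec_zero _).symm)
  have h3 := congrArg (fun v => seqU Q 0 *ᵥ v) h2
  simp only [mulVec_mulVec, mulVec_zero] at h3
  rw [← star_eq_conjTranspose, mem_unitaryGroup_iff.mp hU, one_mulVec] at h3
  simpa [seqZ, firstVec] using congrFun h3 ⟨0, hn⟩

/-- `U_s - B_s` is the conjugate transpose of the inverse of `A_s`. -/
theorem IsShiftedQR.mul_conjTranspose_sub_seqB (hA : IsShiftedQR (permCompanion p n) ρ A Q R)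
    {s : ℕ} (h : denomB p Q s ≠ 0) : A s * (seqU Q s - seqB p Q s)ᴴ = 1 := by
  rw [hA.eq_sub]
  exact unitary_sub_rankOne_mul_inverse
    (seqU_mem_unitaryGroup (fun s => (hA.factor s).unitary) s) rfl h

theorem firstVec_vecMul_permCyclicShift {k : Fin n} (hk : 3 ≤ k.val) :
    (star (firstVec n) ᵥ* permCyclicShift n) k = 0 := by
  rw [vecMul, dotProduct]
  refine Finset.sum_eq_zero fun i _ => ?_
  by_cases hi : i.val = 0
  · rw [permCyclicShift_zero_apply hi hk, mul_zero]
  · simp [firstVec, hi]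

theorem lowerZero_conjTranspose_permCyclicShift (j : ℕ) :
    LowerZero (2 * (j + 1)) (2 * j) (permCyclicShift n)ᴴ := fun i k hi hk => by
  rw [conjTranspose_apply, permCyclicShift_apply_eq_zero hk (by omega) (even_two_mul j), star_zero]

theorem IsShiftedQR.lowerZero (hA : IsShiftedQR (permCompanion p n) ρ A Q R)
    (h : ∀ s, denomB p Q s ≠ 0) {j : ℕ} (hj : 1 ≤ j) :
    ∀ s, LowerZero (2 * (j + 1)) (2 * j) (seqU Q s - seqB p Q s)ᴴ
  | 0 => fun i k hi hk => by
    rw [conjTranspose_apply, Matrix.sub_apply, seqB, Matrix.smul_apply, vecMulVec_apply]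
    simp only [seqU, seqZ]
    -- Since `j ≥ 1`, the columns start at index `4`, beyond the support of `e₁ᴴ Û`.
    rw [firstVec_vecMul_permCyclicShift (by omega),
      permCyclicShift_apply_eq_zero hk (by omega) (even_two_mul j)]
    simp
  | s + 1 => by
    have h1 := hA.mul_conjTranspose_sub_seqB (h s)
    -- Here `K` is `(A s)⁻¹`, which commutes with `A s`.
    have h2 := (hA.lowerZero h hj s).conj_of_mem_closure (hA.branch s)
      (h1.trans (mul_eq_one_comm.mp h1).symm)
    have h3 : (seqU Q (s + 1) - seqB p Q (s + 1))ᴴ =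
        (Q s)ᴴ * (seqU Q s - seqB p Q s)ᴴ * Q s := by
      rw [seqB_succ fun s => (hA.factor s).unitary]
      simp only [seqU, conjTranspose_sub, conjTranspose_mul, conjTranspose_conjTranspose, mul_sub,
        sub_mul, mul_assoc]
    rwa [h3]

theorem IsShiftedQR.upperBlock_eq (hA : IsShiftedQR (permCompanion p n) ρ A Q R)
    (h : ∀ s, denomB p Q s ≠ 0) {j : ℕ} (hj : 1 ≤ j) (s : ℕ) :
    upperBlock (seqU Q s) j = upperBlock (seqB p Q s) j := by
  ext i k
  have := hA.lowerZero h hj s k.val i.val k.2 i.2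
  rwa [conjTranspose_apply, star_eq_zero, Matrix.sub_apply, sub_eq_zero] at this

theorem IsShiftedQR.lowerRankOne (hA : IsShiftedQR (permCompanion p n) ρ A Q R)
    (h : ∀ s, denomB p Q s = 0) {j : ℕ} (hj : 1 ≤ j) :
    ∀ s, (∀ i : Fin n, 2 * (j + 1) ≤ i.val → ((seqU Q s)ᴴ *ᵥ seqZ Q s) i = 0) ∧
      LowerRankOne (2 * (j + 1)) (2 * j) (seqU Q s)ᴴ (star (seqW p Q s) ᵥ* (seqU Q s)ᴴ)
  | 0 => by
    -- The initial block is zero, so `l = 0` and `r` is the extra row itself.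
    refine ⟨fun i hi => ?_, 0, _, 1, ?_, fun k _ => (one_mul _).symm⟩
    · rw [← star_star (seqZ Q 0), ← star_vecMul, Pi.star_apply]
      simp only [seqU, seqZ]
      rw [firstVec_vecMul_permCyclicShift (by omega), star_zero]
    · rw [zero_vecMulVec, sub_zero]
      exact lowerZero_conjTranspose_permCyclicShift j
  | s + 1 => by
    have hQ : Q s * (Q s)ᴴ = 1 := mem_unitaryGroup_iff.mp (hA.factor s).unitary
    obtain ⟨h1, h2, h3⟩ := unitary_sub_rankOne_singular
      (seqU_mem_unitaryGroup (fun s => (hA.factor s).unitary) s) (sub_eq_zero.mp (h s))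
    rw [← hA.eq_sub] at h1 h2 h3
    obtain ⟨h4, h5⟩ := hA.lowerRankOne h hj s
    have hU : (seqU Q (s + 1))ᴴ = (Q s)ᴴ * (seqU Q s)ᴴ * Q s := by
      simp only [seqU, conjTranspose_mul, conjTranspose_conjTranspose, mul_assoc]
    have hx : (seqU Q (s + 1))ᴴ *ᵥ seqZ Q (s + 1) = (Q s)ᴴ *ᵥ ((seqU Q s)ᴴ *ᵥ seqZ Q s) := by
      rw [hU, seqZ, mulVec_mulVec, mulVec_mulVec, mul_assoc, hQ, mul_one]
    have hy : star (seqW p Q (s + 1)) ᵥ* (seqU Q (s + 1))ᴴ =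
        (star (seqW p Q s) ᵥ* (seqU Q s)ᴴ) ᵥ* Q s := by
      rw [hU, seqW, star_mulVec, conjTranspose_conjTranspose, vecMul_vecMul, vecMul_vecMul,
        ← mul_assoc, ← mul_assoc, hQ, one_mul]
    rw [hx, hy, hU]
    exact lowerRankOne_conj_of_mem_closure (hA.branch s) h3 h1 h2 h4 h5

theorem IsShiftedQR.rank_upperBlock_seqU_le (hA : IsShiftedQR (permCompanion p n) ρ A Q R)
    {j : ℕ} (hj : 1 ≤ j) (s : ℕ) : (upperBlock (seqU Q s) j).rank ≤ 1 := by
  have hd := denomB_eq (p := p) fun s => (hA.factor s).unitary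
  by_cases h : denomB p Q 0 = 0
  · exact (hA.lowerRankOne (fun s => (hd s).trans h) hj s).2.rank_upperBlock_le
  · rw [hA.upperBlock_eq (fun s => (hd s).trans_ne h) hj]
    exact rank_upperBlock_smul_vecMulVec_le _ _ _ _

theorem rank_seqB_le (s : ℕ) : (seqB p Q s).rank ≤ 1 := by
  rw [seqB, ← smul_vecMulVec]
  exact rank_vecMulVec_le _ _

theorem unitary_mulVec_ne_zero {V : Matrix (Fin n) (Fin n) ℂ} (hV : V ∈ unitaryGroup (Fin n) ℂ)
    {v : Fin n → ℂ} (hv : v ≠ 0) : V *ᵥ v ≠ 0 := fun h => hv <| by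
  rw [← one_mulVec v, ← mem_unitaryGroup_iff'.mp hV, ← mulVec_mulVec, h, mulVec_zero]

theorem seqW_ne_zero (hQ : ∀ s, Q s ∈ unitaryGroup (Fin n) ℂ) (h : permCoeffVec p n ≠ 0) :
    ∀ s, seqW p Q s ≠ 0
  | 0 => h
  | s + 1 => unitary_mulVec_ne_zero (Unitary.star_mem (hQ s)) (seqW_ne_zero hQ h s)

theorem seqZ_ne_zero (hn : 1 ≤ n) (hQ : ∀ s, Q s ∈ unitaryGroup (Fin n) ℂ) :
    ∀ s, seqZ Q s ≠ 0
  | 0 => fun h => by simpa [seqZ, firstVec] using congrFun h ⟨0, hn⟩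
  | s + 1 => unitary_mulVec_ne_zero (Unitary.star_mem (hQ s)) (seqZ_ne_zero hn hQ s)

theorem rank_seqB_eq_one (hn : 1 ≤ n) (hQ : ∀ s, Q s ∈ unitaryGroup (Fin n) ℂ)
    (hp : permCoeffVec p n ≠ 0) {s : ℕ} (h : denomB p Q s ≠ 0) : (seqB p Q s).rank = 1 := by
  have hU := seqU_mem_unitaryGroup hQ s
  rw [seqB, ← smul_vecMulVec]
  refine rank_vecMulVec_eq_one (smul_ne_zero (inv_ne_zero h)
    (unitary_mulVec_ne_zero hU (seqW_ne_zero hQ hp s))) fun h0 => ?_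
  apply unitary_mulVec_ne_zero (Unitary.star_mem hU) (seqZ_ne_zero hn hQ s)
  rw [← star_eq_zero, star_mulVec, star_eq_conjTranspose, conjTranspose_conjTranspose, h0]

end Iteration

end CompanionQR
end

theorem mainTheorem1 (p : ℂ[X]) (n : ℕ) (hn : 1 ≤ n) (hp : p.natDegree = n)
    (ρ : ℕ → ℂ) (A Q R : ℕ → Matrix (Fin n) (Fin n) ℂ)
    (hA : CompanionQR.IsShiftedQR (CompanionQR.permCompanion p n) ρ A Q R) :
    (∀ s, CompanionQR.seqU Q s ∈ Matrix.unitaryGroup (Fin n) ℂ ∧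
      A s = CompanionQR.seqU Q s -
        Matrix.vecMulVec (CompanionQR.seqZ Q s) (star (CompanionQR.seqW p Q s))) ∧
    (∀ s j, 1 ≤ j → j + 2 ≤ (n + 1) / 2 →
      (CompanionQR.upperBlock (CompanionQR.seqU Q s) j).rank ≤ 1) ∧
    (IsUnit (A 0) →
      (∀ s, CompanionQR.denomB p Q s ≠ 0) ∧
      (∀ s j, 1 ≤ j → j + 2 ≤ (n + 1) / 2 →
        CompanionQR.upperBlock (CompanionQR.seqU Q s) j =
          CompanionQR.upperBlock (CompanionQR.seqB p Q s) j) ∧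
      (∀ s, CompanionQR.seqB p Q (s + 1) =
        (Q s).conjTranspose * CompanionQR.seqB p Q s * Q s) ∧
      (∀ s, (CompanionQR.seqB p Q s).rank ≤ 1) ∧
      (p ≠ C p.leadingCoeff * (X ^ n - 1) → ∀ s, (CompanionQR.seqB p Q s).rank = 1)) := by
  have hQ : ∀ s, Q s ∈ Matrix.unitaryGroup (Fin n) ℂ := fun s => (hA.factor s).unitary
  refine ⟨fun s => ⟨CompanionQR.seqU_mem_unitaryGroup hQ s, hA.eq_sub s⟩,
    fun s j hj _ => hA.rank_upperBlock_seqU_le hj s, fun h0 => ?_⟩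
  have hd := hA.denomB_ne_zero hn h0
  exact ⟨hd, fun s j hj _ => hA.upperBlock_eq hd hj s, CompanionQR.seqB_succ hQ,
    CompanionQR.rank_seqB_le, fun h s => CompanionQR.rank_seqB_eq_one hn hQ
      (CompanionQR.permCoeffVec_ne_zero hn hp h) (hd s)⟩
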